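/- Let $D<-3$ be a squarefree integer, $K=\mathbb Q(\sqrt D)\subset\mathbb C$ with ring of integers $\mathcal O$, let $n\ge 13$, and let $\Lambda$ be a hermitian $\mathcal O$-lattice of signature $(n,1)$, i.e. a free $\mathcal O$-module of rank $n+1$ with a $K$-valued hermitian form $h$ (linear in the first variable) of signature $(n,1)$. Let $\Gamma\subset U(\Lambda)$ be a subgroup of finite index. Let $F$ be a cusp, given by an isotropic line $E\subset\Lambda_K=\Lambda\otimes_{\mathcal O}K$, and choose a basis $b_1,\dots,b_{n+1}$ of $\Lambda_K$ such that $b_1$ spans $E$ and $h(x,y)={}^t\bar y\,Q\,x$ with $$Q=\begin{pmatrix}0&0&a\\0&B&0\\ \bar a&0&0\end{pmatrix},\qquad B\in M_{n-1}(K).$$ Let $N(F)_{\mathbb Z}$ be the stabiliser of $E$ in $\Gamma$; its elements are block matrices $\begin{pmatrix}u&v&w\\0&X&y\\0&0&z\end{pmatrix}$. Let $U(F)_{\mathbb Z}\cong\mathbb Z$ be the normal subgroup of those with $u=z=1$, $X=I$, $v=0$, $y=0$, $w\in ia\mathbb R$, and let $\sigma=iax$, $x>0$, be the generator of the group of the corresponding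 $w$. The group $G(F)=N(F)_{\mathbb Z}/U(F)_{\mathbb Z}$ acts on the partial quotient of complex hyperbolic $n$-space by $U(F)_{\mathbb Z}$; in the coordinates $(\theta,\underline w)$, $\theta=e^{2\pi i\alpha/\sigma}$, of the point $(\alpha:\underline w:1)$ this action extends to the boundary $\theta=0$ by $$(\theta,\underline w)\mapsto\bigl(\theta\,e^{2\pi i(v\underline w+w)/(z\sigma)},\ z^{-1}(X\underline w+y)\bigr).$$ Let $g\in G(F)$ fix a boundary point $(0,\underline w_0)$, $\underline w_0\in\mathbb C^{n-1}$. Suppose that $h=g^k$ acts on the tangent space $V\cong\mathbb C^n$ at $(0,\underline w_0)$ as a quasi-reflection (a linear map of finite order whose fixed space is a hyperplane), and that $k\ge1$ is minimal with this property. Let $l$ be the order of $h$ on $V$, let $\zeta\in\mathbb C$ be any primitive $lk$-th root of unity, and let $\zeta^{a_1},\dots,\zeta^{a_n}$, $0\le a_i<lk$, be the eigenvalues of $g$ on $V$ with multiplicity, numbered so that $\zeta^{ka_n}\ne1$ is the nontrivial eigenvalue of $h$. Then, with $\{q\}$ the fractional part of $q$, $$\Sigma'(g^f):=\left\{\frac{fa_n}{k}\right\}+\sum_{i=1}^{n-1}\left\{\frac{fa_i}{lk}\right\}\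 \ge\ 1\qquad\text{for every } 1\le f<k.$$ -/

import Mathlib

open scoped ComplexConjugate NumberField

noncomputable section

namespace BallQuotient

/-- The imaginary quadratic number field `K = ℚ(√D)`, `D < 0` a squarefree integer, together with
an embedding in `ℂ`; the star of `K` is complex conjugation. -/
structure ImaginaryQuadraticField (D : ℤ) (K : Type*) [Field K] [NumberField K] [StarRing K] where
  toComplex : K →+* ℂ
  squarefree : Squarefree D
  neg : D < 0
  finrank_eq : Module.finrank ℚ K = 2
  exists_sqrt : ∃ δ : K, δ ^ 2 = (D : K)
  map_star : ∀ x, toComplex (star x) = conj (toComplex x)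

namespace ImaginaryQuadraticField

variable {D : ℤ} {K : Type*} [Field K] [NumberField K] [StarRing K]

theorem star_ratCast (𝕂 : ImaginaryQuadraticField D K) (q : ℚ) : star (q : K) = q :=
  𝕂.toComplex.injective (by rw [𝕂.map_star]; simp)

theorem exists_rat_of_star_eq (𝕂 : ImaginaryQuadraticField D K) {t : K} (ht : star t = t) :
    ∃ q : ℚ, t = q := by
  obtain ⟨δ, hδ⟩ := 𝕂.exists_sqrt
  have hD : (D : ℝ) < 0 := by exact_mod_cast 𝕂.neg
  have h1 : 𝕂.toComplex δ ^ 2 = (D : ℂ) := by rw [← map_pow, hδ]; simp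
  have hre : (𝕂.toComplex δ).re = 0 := by
    have h2 := congrArg Complex.im h1
    have h3 := congrArg Complex.re h1
    simp [pow_two] at h2 h3
    by_contra h
    have : (𝕂.toComplex δ).im = 0 := by
      have : (𝕂.toComplex δ).re * (𝕂.toComplex δ).im = 0 := by linarith
      simpa [h] using this
    rw [this] at h3
    nlinarith [mul_self_nonneg (𝕂.toComplex δ).re]
  have hstar : star δ = -δ := by
    apply 𝕂.toComplex.injective
    rw [𝕂.map_star, map_neg]
    apply Complex.ext <;> simp [hre]
  have hδ0 : δ ≠ 0 := by
    rintro rfl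
    have := 𝕂.neg
    have h : (D : K) = 0 := by rw [← hδ]; simp
    have : D = 0 := by exact_mod_cast h
    omega
  have hli : LinearIndependent ℚ ![(1 : K), δ] := by
    rw [LinearIndependent.pair_iff]
    intro p q h
    have h' := congrArg star h
    simp only [Rat.smul_def, star_add, star_mul, star_one, hstar, star_zero,
      𝕂.star_ratCast] at h h'
    have hp : (p : K) = 0 := by linear_combination (h + h') / 2
    have hq : (q : K) * δ = 0 := by rw [hp] at h; simpa using h
    refine ⟨by exact_mod_cast hp, ?_⟩
    have := (mul_eq_zero.mp hq).resolve_right hδ0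
    exact_mod_cast this
  have hspan := hli.span_eq_top_of_card_eq_finrank (by simp [𝕂.finrank_eq])
  have hmem : t ∈ Submodule.span ℚ (Set.range ![(1 : K), δ]) := by rw [hspan]; trivial
  simp only [Matrix.range_cons, Matrix.range_empty, Set.union_empty, Set.singleton_union] at hmem
  obtain ⟨p, q, h⟩ := Submodule.mem_span_pair.mp hmem
  refine ⟨p, ?_⟩
  simp only [Rat.smul_def] at h
  have h' := congrArg star h
  rw [ht] at h'
  simp only [star_add, star_mul, star_one, hstar, 𝕂.star_ratCast] at h'
  linear_combination (-h - h') / 2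

theorem exists_int_mul_star (𝕂 : ImaginaryQuadraticField D K) {x : K} (hx : IsIntegral ℤ x) :
    ∃ m : ℤ, x * star x = m ∧ (m : ℝ) = ‖𝕂.toComplex x‖ ^ 2 := by
  have hs : IsIntegral ℤ (star x) := hx.map (starRingEnd K).toIntAlgHom
  obtain ⟨q, hq⟩ := 𝕂.exists_rat_of_star_eq (t := x * star x) (by simp [mul_comm])
  have hqi : IsIntegral ℤ q := by
    have h : IsIntegral ℤ (algebraMap ℚ K q) := by
      rw [eq_ratCast, ← hq]; exact hx.mul hs
    exact (isIntegral_algebraMap_iff (algebraMap ℚ K).injective).mp h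
  obtain ⟨m, rfl⟩ := IsIntegrallyClosed.isIntegral_iff.mp hqi
  refine ⟨m, by simpa using hq, ?_⟩
  have h := congrArg 𝕂.toComplex hq
  rw [map_mul, 𝕂.map_star, Complex.mul_conj, Complex.normSq_eq_norm_sq] at h
  simp at h
  exact_mod_cast h.symm

theorem one_le_norm (𝕂 : ImaginaryQuadraticField D K) {x : K} (hx : IsIntegral ℤ x)
    (h0 : x ≠ 0) : 1 ≤ ‖𝕂.toComplex x‖ := by
  obtain ⟨m, -, hm⟩ := 𝕂.exists_int_mul_star hx
  have hpos : 0 < ‖𝕂.toComplex x‖ := by simpa using h0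
  have : (0 : ℝ) < m := by rw [hm]; positivity
  have : (1 : ℝ) ≤ m := by exact_mod_cast (show (0 : ℤ) < m by exact_mod_cast this)
  nlinarith

theorem mul_star_eq_one (𝕂 : ImaginaryQuadraticField D K) {x y : K} (hx : IsIntegral ℤ x)
    (hy : IsIntegral ℤ y) (h : x * y = 1) : x * star x = 1 := by
  have hx1 := 𝕂.one_le_norm hx (left_ne_zero_of_mul_eq_one h)
  have hy1 := 𝕂.one_le_norm hy (right_ne_zero_of_mul_eq_one h)
  have hxy : ‖𝕂.toComplex x‖ * ‖𝕂.toComplex y‖ = 1 := by rw [← norm_mul, ← map_mul, h]; simp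
  have h1 : ‖𝕂.toComplex x‖ = 1 := by nlinarith
  obtain ⟨m, hm, hm'⟩ := 𝕂.exists_int_mul_star hx
  rw [h1] at hm'
  have : m = 1 := by exact_mod_cast (by simpa using hm' : (m : ℝ) = 1)
  rw [hm, this]; simp

end ImaginaryQuadraticField

/-- A hermitian `𝓞`-lattice of signature `(n, 1)` in the `K`-vector space `M = Λ ⊗ K`: the form is
linear in the first and conjugate-linear in the second variable, and the lattice `Λ` is a free
`𝓞`-module of rank `n + 1` which spans `M`. -/
structure HermitianLattice {D : ℤ} {K : Type*} [Field K] [NumberField K] [StarRing K]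
    (𝕂 : ImaginaryQuadraticField D K) (n : ℕ) (M : Type*) [AddCommGroup M] [Module K M]
    [Module (𝓞 K) M] where
  form : M →ₗ[K] M →ₗ⋆[K] K
  hermitian : ∀ x y, star (form x y) = form y x
  signature : ∃ v : Module.Basis (Fin (n + 1)) K M,
    (∀ i j, i ≠ j → form (v i) (v j) = 0) ∧
    (∀ i : Fin n, 0 < (𝕂.toComplex (form (v i.castSucc) (v i.castSucc))).re) ∧
    (𝕂.toComplex (form (v (Fin.last n)) (v (Fin.last n)))).re < 0
  lattice : Submodule (𝓞 K) M
  free : ∃ e : Module.Basis (Fin (n + 1)) K M, lattice = Submodule.span (𝓞 K) (Set.range e)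

namespace HermitianLattice

variable {D : ℤ} {K : Type*} [Field K] [NumberField K] [StarRing K]
  {𝕂 : ImaginaryQuadraticField D K} {n : ℕ} {M : Type*} [AddCommGroup M] [Module K M]
  [Module (𝓞 K) M]

/-- The group `U(Λ)` of automorphisms of the hermitian lattice `Λ`. -/
def unitaryGroup (L : HermitianLattice 𝕂 n M) : Subgroup (M ≃ₗ[K] M) where
  carrier := {g | (∀ x y, L.form (g x) (g y) = L.form x y) ∧ ∀ x, g x ∈ L.lattice ↔ x ∈ L.lattice}
  one_mem' := by simp
  mul_mem' := by
    rintro a b ⟨ha, ha'⟩ ⟨hb, hb'⟩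
    exact ⟨fun x y => by simp [ha, hb], fun x => by simp [ha', hb']⟩
  inv_mem' := by
    rintro a ⟨ha, ha'⟩
    have h : ∀ x, a (a⁻¹ x) = x := fun x => LinearEquiv.apply_symm_apply a x
    exact ⟨fun x y => by rw [← ha, h, h], fun x => by rw [← ha', h]⟩

/-- A cusp `F`: an isotropic line `E` of `Λ ⊗ K`. -/
structure Cusp (L : HermitianLattice 𝕂 n M) where
  line : Submodule K M
  finrank_line : Module.finrank K line = 1
  isotropic : ∀ x ∈ line, ∀ y ∈ line, L.form x y = 0

/-- The index set of the basis `b₁, b₂, …, bₙ, bₙ₊₁`, cut into blocks of size `1`, `n - 1`, `1`. -/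
abbrev CuspIndex (n : ℕ) := Unit ⊕ (Fin (n - 1) ⊕ Unit)

/-- The index of `b₁`. -/
abbrev first {n : ℕ} : CuspIndex n := Sum.inl ()

/-- The indices of `b₂, …, bₙ`. -/
abbrev mid {n : ℕ} (i : Fin (n - 1)) : CuspIndex n := Sum.inr (Sum.inl i)

/-- The index of `bₙ₊₁`. -/
abbrev last {n : ℕ} : CuspIndex n := Sum.inr (Sum.inr ())

/-- A basis of `Λ ⊗ K` adapted to the cusp: `b₁` spans the isotropic line, and the form is
`h(x, y) = yᴴ Q x` with `Q = (0, 0, a; 0, B, 0; ā, 0, 0)`. -/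
structure Cusp.AdaptedBasis {L : HermitianLattice 𝕂 n M} (F : L.Cusp) where
  basis : Module.Basis (CuspIndex n) K M
  span_first : Submodule.span K {basis first} = F.line
  form_mid_first : ∀ i, L.form (basis (mid i)) (basis first) = 0
  form_mid_last : ∀ i, L.form (basis (mid i)) (basis last) = 0
  form_last_last : L.form (basis last) (basis last) = 0

namespace Cusp

variable {L : HermitianLattice 𝕂 n M}

/-- `N(F)_ℤ`: the stabiliser in `Γ` of the isotropic line `E`. -/
def stabilizer (F : L.Cusp) (Γ : Subgroup L.unitaryGroup) : Subgroup Γ where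
  carrier := {γ | ∀ x, (γ : M ≃ₗ[K] M) x ∈ F.line ↔ x ∈ F.line}
  one_mem' := by simp
  mul_mem' := by
    intro a b ha hb x
    simpa using (ha _).trans (hb x)
  inv_mem' := by
    intro a ha x
    have h : (a : M ≃ₗ[K] M) ((a : M ≃ₗ[K] M)⁻¹ x) = x := LinearEquiv.apply_symm_apply _ x
    simpa [h] using (ha ((a : M ≃ₗ[K] M)⁻¹ x)).symm

/-- The action of `N(F)_ℤ` on `Λ ⊗ K`. -/
def toLinear (F : L.Cusp) (Γ : Subgroup L.unitaryGroup) : F.stabilizer Γ →* (M ≃ₗ[K] M) :=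
  L.unitaryGroup.subtype.comp (Γ.subtype.comp (F.stabilizer Γ).subtype)

/-- `E^⊥` -/
def perp (F : L.Cusp) : Set M := {x | ∀ y ∈ F.line, L.form x y = 0}

variable {F : L.Cusp} {Γ : Subgroup L.unitaryGroup}

theorem form_toLinear (γ : F.stabilizer Γ) (x y : M) :
    L.form (F.toLinear Γ γ x) (F.toLinear Γ γ y) = L.form x y :=
  γ.1.1.2.1 x y

theorem toLinear_mem_lattice (γ : F.stabilizer Γ) {x : M} :
    F.toLinear Γ γ x ∈ L.lattice ↔ x ∈ L.lattice :=
  γ.1.1.2.2 x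

theorem toLinear_mem_line (γ : F.stabilizer Γ) {x : M} :
    F.toLinear Γ γ x ∈ F.line ↔ x ∈ F.line :=
  γ.2 x

theorem toLinear_inv_apply (γ : F.stabilizer Γ) (x : M) :
    F.toLinear Γ γ (F.toLinear Γ γ⁻¹ x) = x := by
  rw [map_inv]; exact LinearEquiv.apply_symm_apply _ x

theorem toLinear_mem_perp (γ : F.stabilizer Γ) {x : M} (hx : x ∈ F.perp) :
    F.toLinear Γ γ x ∈ F.perp := by
  intro y hy
  rw [← toLinear_inv_apply γ y, form_toLinear]
  exact hx _ ((toLinear_mem_line γ⁻¹).mpr hy)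

/-- `U(F)_ℤ`: the elements of `N(F)_ℤ` which act trivially on `E^⊥`. In an adapted basis these are
the matrices `(1, 0, iax; 0, I, 0; 0, 0, 1)`, `x` real; over `ℝ` they form the centre of the
unipotent radical of the stabiliser of `E`. -/
def centre (F : L.Cusp) (Γ : Subgroup L.unitaryGroup) : Subgroup (F.stabilizer Γ) where
  carrier := {γ | ∀ x ∈ F.perp, F.toLinear Γ γ x = x}
  one_mem' := by simp
  mul_mem' := by
    intro a b ha hb x hx
    simp [hb x hx, ha x hx]
  inv_mem' := by
    intro a ha x hx
    have := ha _ (toLinear_mem_perp a⁻¹ hx)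
    rw [toLinear_inv_apply] at this
    exact this.symm

instance : (F.centre Γ).Normal where
  conj_mem := by
    intro t ht γ x hx
    have := ht _ (toLinear_mem_perp γ⁻¹ hx)
    rw [map_mul, map_mul, LinearEquiv.mul_apply, LinearEquiv.mul_apply, this, toLinear_inv_apply]

/-- The group `G(F) = N(F)_ℤ / U(F)_ℤ`. -/
abbrev boundaryGroup (F : L.Cusp) (Γ : Subgroup L.unitaryGroup) : Type _ :=
  F.stabilizer Γ ⧸ F.centre Γ

namespace AdaptedBasis

/-- The number `a = h(bₙ₊₁, b₁)`. -/
def a (β : F.AdaptedBasis) : ℂ := 𝕂.toComplex (L.form (β.basis last) (β.basis first))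

/-- The `(i, j)` entry, in `K`, of the matrix of `γ` in the adapted basis. -/
def coeff (β : F.AdaptedBasis) (γ : F.stabilizer Γ) (i j : CuspIndex n) : K :=
  β.basis.repr (F.toLinear Γ γ (β.basis j)) i

/-- The entry `u` of `γ = (u, v, w; 0, X, y; 0, 0, z)`. -/
def u (β : F.AdaptedBasis) (γ : F.stabilizer Γ) : ℂ := 𝕂.toComplex (β.coeff γ first first)

/-- The row `v` of `γ = (u, v, w; 0, X, y; 0, 0, z)`. -/
def v (β : F.AdaptedBasis) (γ : F.stabilizer Γ) : Fin (n - 1) → ℂ :=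
  fun j => 𝕂.toComplex (β.coeff γ first (mid j))

/-- The entry `w` of `γ = (u, v, w; 0, X, y; 0, 0, z)`. -/
def w (β : F.AdaptedBasis) (γ : F.stabilizer Γ) : ℂ := 𝕂.toComplex (β.coeff γ first last)

/-- The block `X` of `γ = (u, v, w; 0, X, y; 0, 0, z)`. -/
def X (β : F.AdaptedBasis) (γ : F.stabilizer Γ) : Matrix (Fin (n - 1)) (Fin (n - 1)) ℂ :=
  Matrix.of fun i j => 𝕂.toComplex (β.coeff γ (mid i) (mid j))

/-- The column `y` of `γ = (u, v, w; 0, X, y; 0, 0, z)`. -/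
def y (β : F.AdaptedBasis) (γ : F.stabilizer Γ) : Fin (n - 1) → ℂ :=
  fun i => 𝕂.toComplex (β.coeff γ (mid i) last)

/-- The entry `z` of `γ = (u, v, w; 0, X, y; 0, 0, z)`. -/
def z (β : F.AdaptedBasis) (γ : F.stabilizer Γ) : ℂ := 𝕂.toComplex (β.coeff γ last last)

/-- The generator `σ = iax`, `x > 0` minimal, of the group of translations `α ↦ α + iax` which
`U(F)_ℤ ≅ ℤ` induces on the first coordinate. With this sign `exp (2πiα/σ)` tends to `0` at the
cusp, where `2 Re (ā α) → -∞`. -/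
def period (β : F.AdaptedBasis) (Γ : Subgroup L.unitaryGroup) : ℂ :=
  Complex.I * β.a * (sInf {x : ℝ | 0 < x ∧ ∃ γ ∈ F.centre Γ, β.w γ = Complex.I * β.a * x} : ℝ)

/-- The projective action of `γ` on points `(α : w : 1)` of hyperbolic space:
`(α, w) ↦ ((uα + vw + w')/z, (Xw + y)/z)`, where `w'` is the corner entry of `γ`. -/
def affineAction (β : F.AdaptedBasis) (γ : F.stabilizer Γ) (p : ℂ × (Fin (n - 1) → ℂ)) :
    ℂ × (Fin (n - 1) → ℂ) :=
  ((β.u γ * p.1 + β.v γ ⬝ᵥ p.2 + β.w γ) / β.z γ, (β.z γ)⁻¹ • (β.X γ).mulVec p.2 + (β.z γ)⁻¹ • β.y γ)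

/-- The quotient map by `U(F)_ℤ` in coordinates: `(α, w) ↦ (θ, w)`, `θ = exp (2πiα/σ)`. -/
def torusCoordinates (β : F.AdaptedBasis) (Γ : Subgroup L.unitaryGroup)
    (p : ℂ × (Fin (n - 1) → ℂ)) : ℂ × (Fin (n - 1) → ℂ) :=
  (Complex.exp (2 * Real.pi * Complex.I / β.period Γ * p.1), p.2)

/-- The action of `γ` in the coordinates `(θ, w)`, extended to the boundary `θ = 0`. -/
def extendedAction (β : F.AdaptedBasis) (γ : F.stabilizer Γ) (p : ℂ × (Fin (n - 1) → ℂ)) :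
    ℂ × (Fin (n - 1) → ℂ) :=
  (p.1 * Complex.exp (2 * Real.pi * Complex.I / β.period Γ * ((β.v γ ⬝ᵥ p.2 + β.w γ) / β.z γ)),
    (β.z γ)⁻¹ • (β.X γ).mulVec p.2 + (β.z γ)⁻¹ • β.y γ)

variable (β : F.AdaptedBasis)

theorem form_first_first : L.form (β.basis first) (β.basis first) = 0 := by
  have h : β.basis first ∈ F.line := by
    rw [← β.span_first]; exact Submodule.mem_span_singleton_self _
  exact F.isotropic _ h _ h

theorem form_first_mid (i) : L.form (β.basis first) (β.basis (mid i)) = 0 := by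
  rw [← L.hermitian, β.form_mid_first, star_zero]

theorem form_first_right (x : M) : L.form x (β.basis first) =
    β.basis.repr x last * L.form (β.basis last) (β.basis first) := by
  have h := congrArg (fun m => L.form m (β.basis first)) (β.basis.sum_repr x)
  simp only [map_add, LinearMap.add_apply, map_sum, LinearMap.sum_apply, map_smul,
    LinearMap.smul_apply, Fintype.sum_sum_type,
    Finset.univ_unique, Finset.sum_singleton, PUnit.default_eq_unit, β.form_first_first,
    β.form_mid_first, smul_eq_mul, mul_zero, Finset.sum_const_zero, zero_add] at h
  exact h.symm

theorem form_nondegenerate {x : M} (h : ∀ y, L.form y x = 0) : x = 0 := by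
  obtain ⟨e, h0, h1, h2⟩ := L.signature
  have hne : ∀ i, L.form (e i) (e i) ≠ 0 := by
    intro i
    induction i using Fin.lastCases with
    | last => intro h; rw [h] at h2; simp at h2
    | cast i => intro h; have := h1 i; rw [h] at this; simp at this
  rw [← e.sum_repr x]
  refine Finset.sum_eq_zero fun i _ => ?_
  have := h (e i)
  rw [← e.sum_repr x, map_sum, Finset.sum_eq_single i] at this
  · rw [map_smulₛₗ, smul_eq_mul, mul_eq_zero] at this
    have := this.resolve_right (hne i)
    rw [(map_eq_zero _).mp this, zero_smul]
  · intro j _ hj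
    rw [map_smulₛₗ, h0 i j hj.symm, smul_zero]
  · simp

theorem form_last_first_ne : L.form (β.basis last) (β.basis first) ≠ 0 := by
  intro h
  refine β.basis.ne_zero first (form_nondegenerate (L := L) fun y => ?_)
  rw [β.form_first_right, h, mul_zero]

theorem mem_perp_iff {x : M} : x ∈ F.perp ↔ β.basis.repr x last = 0 := by
  constructor
  · intro h
    have := h (β.basis first) (by rw [← β.span_first]; exact Submodule.mem_span_singleton_self _)
    rw [β.form_first_right] at this
    exact (mul_eq_zero.mp this).resolve_right β.form_last_first_ne
  · intro h y hy
    rw [← β.span_first] at hy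
    obtain ⟨c, rfl⟩ := Submodule.mem_span_singleton.mp hy
    rw [map_smulₛₗ, β.form_first_right, h, zero_mul, smul_zero]

theorem toLinear_first (γ : F.stabilizer Γ) :
    F.toLinear Γ γ (β.basis first) = β.coeff γ first first • β.basis first := by
  have h : F.toLinear Γ γ (β.basis first) ∈ F.line := by
    rw [toLinear_mem_line, ← β.span_first]; exact Submodule.mem_span_singleton_self _
  rw [← β.span_first] at h
  obtain ⟨c, hc⟩ := Submodule.mem_span_singleton.mp h
  rw [coeff, ← hc]; simp

theorem last_toLinear (γ : F.stabilizer Γ) (x : M) :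
    β.basis.repr (F.toLinear Γ γ x) last = β.coeff γ last last * β.basis.repr x last := by
  have hp : x - β.basis.repr x last • β.basis last ∈ F.perp := by
    rw [β.mem_perp_iff]; simp
  have h := β.mem_perp_iff.mp (toLinear_mem_perp γ hp)
  simp only [map_sub, map_smul, Finsupp.sub_apply, Finsupp.smul_apply, smul_eq_mul] at h
  rw [coeff]; linear_combination h

theorem z_mul_star_u (γ : F.stabilizer Γ) :
    β.coeff γ last last * star (β.coeff γ first first) = 1 := by
  have h := form_toLinear γ (β.basis last) (β.basis first)
  rw [β.toLinear_first, map_smulₛₗ, β.form_first_right, β.last_toLinear] at h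
  simp only [starRingEnd_apply, smul_eq_mul, Module.Basis.repr_self, Finsupp.single_eq_same, mul_one] at h
  refine mul_right_cancel₀ β.form_last_first_ne ?_
  linear_combination h

theorem z_ne_zero (γ : F.stabilizer Γ) : β.z γ ≠ 0 := by
  simpa [z] using left_ne_zero_of_mul_eq_one (β.z_mul_star_u γ)

theorem exists_mem_lattice (f : M →ₗ[K] K) (hf : f ≠ 0) : ∃ x ∈ L.lattice, f x ≠ 0 := by
  obtain ⟨e, he⟩ := L.free
  by_contra! h
  refine hf (e.ext fun i => ?_)
  rw [h _ (he ▸ Submodule.subset_span ⟨i, rfl⟩)]; rfl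

theorem toLinear_apply_centre {t : F.stabilizer Γ} (ht : t ∈ F.centre Γ) :
    F.toLinear Γ t (β.basis last) = β.basis last + β.coeff t first last • β.basis first := by
  set δ := F.toLinear Γ t (β.basis last) - β.basis last with hδ
  have h1 : ∀ x ∈ F.perp, L.form x δ = 0 := by
    intro x hx
    have := form_toLinear t x (β.basis last)
    rw [ht x hx] at this
    rw [hδ, map_sub, this, sub_self]
  have hb1 : β.basis first ∈ F.perp := by rw [β.mem_perp_iff]; simp
  have h2 : β.basis.repr δ last = 0 := by
    have := h1 _ hb1
    rw [← L.hermitian, β.form_first_right, star_eq_zero] at this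
    exact (mul_eq_zero.mp this).resolve_right β.form_last_first_ne
  have hc : β.coeff t first last = β.basis.repr δ first := by
    rw [hδ, coeff]; simp
  have hr : δ - β.basis.repr δ first • β.basis first = 0 := by
    refine form_nondegenerate (L := L) fun x => ?_
    have hx : x - β.basis.repr x last • β.basis last ∈ F.perp := by
      rw [β.mem_perp_iff]; simp
    have e1 : L.form (x - β.basis.repr x last • β.basis last)
        (δ - β.basis.repr δ first • β.basis first) = 0 := by
      rw [map_sub, h1 _ hx, map_smulₛₗ, β.form_first_right, β.mem_perp_iff.mp hx]
      simp
    have e2 : L.form (δ - β.basis.repr δ first • β.basis first) (β.basis last) = 0 := by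
      have h := congrArg (fun m => L.form m (β.basis last)) (β.basis.sum_repr δ)
      simp only [map_add, LinearMap.add_apply, map_sum, LinearMap.sum_apply, map_smul, LinearMap.smul_apply,
        Fintype.sum_sum_type, Finset.univ_unique, Finset.sum_singleton, PUnit.default_eq_unit, h2,
        β.form_mid_last, smul_eq_mul, mul_zero, zero_mul, Finset.sum_const_zero, add_zero] at h
      rw [map_sub, LinearMap.sub_apply, ← h, map_smul, LinearMap.smul_apply, smul_eq_mul, sub_self]
    have e3 : L.form (β.basis last) (δ - β.basis.repr δ first • β.basis first) = 0 := by
      rw [← L.hermitian, e2, star_zero]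
    rw [map_sub L.form, LinearMap.sub_apply, map_smul L.form, LinearMap.smul_apply, e3, smul_zero,
      sub_zero] at e1
    exact e1
  rw [hc, ← sub_eq_zero.mp hr, hδ]; abel

theorem toLinear_centre {t : F.stabilizer Γ} (ht : t ∈ F.centre Γ) (x : M) :
    F.toLinear Γ t x = x + (β.coeff t first last * β.basis.repr x last) • β.basis first := by
  have hx : x - β.basis.repr x last • β.basis last ∈ F.perp := by
    rw [β.mem_perp_iff]; simp
  have h := ht _ hx
  rw [map_sub, map_smul, β.toLinear_apply_centre ht, smul_add, smul_smul] at h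
  rw [mul_comm, ← sub_eq_zero]
  rw [← sub_eq_zero] at h
  rw [← h]; abel

theorem a_ne_zero : β.a ≠ 0 := by
  simpa [a] using β.form_last_first_ne

theorem w_centre {t : F.stabilizer Γ} (ht : t ∈ F.centre Γ) :
    ∃ x : ℝ, β.w t = Complex.I * β.a * x := by
  have h := form_toLinear t (β.basis last) (β.basis last)
  rw [β.toLinear_apply_centre ht] at h
  simp only [map_add, LinearMap.add_apply, map_smulₛₗ, LinearMap.smul_apply,
    β.form_last_last, β.form_first_first, smul_eq_mul, mul_zero, add_zero, zero_add,
    RingHom.id_apply] at h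
  rw [← L.hermitian (β.basis last) (β.basis first), starRingEnd_apply] at h
  have h' := congrArg 𝕂.toComplex h
  simp only [map_add, map_mul, 𝕂.map_star, map_zero] at h'
  change β.w t * conj β.a + conj (β.w t) * β.a = 0 at h'
  refine ⟨(β.w t / (Complex.I * β.a)).re, ?_⟩
  have ha := β.a_ne_zero
  have hq : conj (β.w t / (Complex.I * β.a)) = β.w t / (Complex.I * β.a) := by
    have ha' : conj β.a ≠ 0 := by simpa using ha
    rw [map_div₀, map_mul, Complex.conj_I]
    field_simp
    linear_combination -h'
  rw [Complex.conj_eq_iff_re.mp hq]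
  field_simp

/-- The matrices of the elements of `U(F)_ℤ`. -/
theorem mem_centre_iff {t : F.stabilizer Γ} : t ∈ F.centre Γ ↔
    β.u t = 1 ∧ β.v t = 0 ∧ (∃ x : ℝ, β.w t = Complex.I * β.a * x) ∧ β.X t = 1 ∧ β.y t = 0 ∧
      β.z t = 1 := by
  constructor
  · intro ht
    have hmid : ∀ j, F.toLinear Γ t (β.basis (mid j)) = β.basis (mid j) := fun j =>
      ht _ (by rw [β.mem_perp_iff]; simp)
    refine ⟨?_, ?_, β.w_centre ht, ?_, ?_, ?_⟩
    · rw [u, coeff, β.toLinear_centre ht]; simp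
    · ext j; rw [v, coeff, hmid]; simp
    · ext i j
      rw [X, Matrix.of_apply, coeff, hmid, Module.Basis.repr_self, Matrix.one_apply,
        Finsupp.single_apply]
      by_cases hij : i = j
      · simp [hij]
      · simp [hij, Ne.symm hij]
    · ext i; rw [y, coeff, β.toLinear_centre ht]; simp
    · rw [z, coeff, β.toLinear_centre ht]; simp
  · rintro ⟨hu, hv, -, hX, -, -⟩
    have h1 : F.toLinear Γ t (β.basis first) = β.basis first := by
      have : β.coeff t first first = 1 := 𝕂.toComplex.injective (by rw [map_one]; exact hu)
      rw [β.toLinear_first, this, one_smul]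
    have h2 : ∀ j, F.toLinear Γ t (β.basis (mid j)) = β.basis (mid j) := by
      intro j
      refine β.basis.ext_elem fun i => ?_
      rcases i with _ | i | _
      · have : β.coeff t first (mid j) = 0 :=
          𝕂.toComplex.injective (by rw [map_zero]; exact congrFun hv j)
        change β.coeff t first (mid j) = _
        rw [this]; simp
      · have h := congrFun (congrFun hX i) j
        change β.coeff t (mid i) (mid j) = _
        apply 𝕂.toComplex.injective
        refine h.trans ?_
        rw [Module.Basis.repr_self, Matrix.one_apply, Finsupp.single_apply]
        by_cases hij : i = j
        · simp [hij]
        · simp [hij, Ne.symm hij]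
      · change β.basis.repr _ last = β.basis.repr _ last
        rw [β.last_toLinear]; simp
    intro x hx
    rw [β.mem_perp_iff] at hx
    rw [← β.basis.sum_repr x]
    simp only [map_sum, map_smul]
    refine Finset.sum_congr rfl fun i _ => ?_
    rcases i with _ | i | _
    · exact congrArg _ h1
    · exact congrArg _ (h2 i)
    · change β.basis.repr x last • _ = β.basis.repr x last • _
      rw [hx, zero_smul, zero_smul]

theorem w_mul {s t : F.stabilizer Γ} (hs : s ∈ F.centre Γ) (ht : t ∈ F.centre Γ) :
    β.w (s * t) = β.w s + β.w t := by
  rw [w, coeff, map_mul, LinearEquiv.mul_apply, β.toLinear_centre hs, β.toLinear_centre ht]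
  simp [w, add_comm]

variable [IsScalarTower (𝓞 K) K M]

theorem isIntegral_z (γ : F.stabilizer Γ) : IsIntegral ℤ (β.coeff γ last last) := by
  let f : M →ₗ[K] K := β.basis.coord last
  let N : Submodule (𝓞 K) K := L.lattice.map (f.restrictScalars (𝓞 K))
  have hN : N ≠ ⊥ := by
    obtain ⟨x, hx, hx'⟩ := exists_mem_lattice (L := L) f (by
      intro h
      have := LinearMap.congr_fun h (β.basis last)
      simp [f] at this)
    intro h
    have : f x ∈ N := ⟨x, hx, rfl⟩
    rw [h] at this
    exact hx' this
  have hfg : N.FG := by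
    obtain ⟨e, he⟩ := L.free
    exact Submodule.FG.map _ (he ▸ Submodule.fg_span (Set.finite_range e))
  have h := isIntegral_of_smul_mem_submodule N hN hfg (β.coeff γ last last) (by
    rintro _ ⟨x, hx, rfl⟩
    refine ⟨F.toLinear Γ γ x, (toLinear_mem_lattice γ).mpr hx, ?_⟩
    exact β.last_toLinear γ x)
  exact isIntegral_trans (R := ℤ) (A := 𝓞 K) _ h

theorem z_eq_u (γ : F.stabilizer Γ) : β.coeff γ last last = β.coeff γ first first := by
  have h : β.coeff γ last last * β.coeff γ⁻¹ last last = 1 := by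
    have := β.last_toLinear γ (F.toLinear Γ γ⁻¹ (β.basis last))
    rw [toLinear_inv_apply] at this
    simpa [coeff] using this.symm
  have h1 := 𝕂.mul_star_eq_one (β.isIntegral_z γ) (β.isIntegral_z γ⁻¹) h
  have h2 := β.z_mul_star_u γ
  have h3 : star (β.coeff γ last last) = star (β.coeff γ first first) :=
    mul_left_cancel₀ (left_ne_zero_of_mul_eq_one h1) (h1.trans h2.symm)
  exact star_injective h3

/-- The extended action is the one induced by the action on hyperbolic space. -/
theorem extendedAction_torusCoordinates (γ : F.stabilizer Γ) (p : ℂ × (Fin (n - 1) → ℂ)) :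
    β.extendedAction γ (β.torusCoordinates Γ p) = β.torusCoordinates Γ (β.affineAction γ p) := by
  refine Prod.ext ?_ rfl
  have hz := β.z_ne_zero γ
  have hu : β.u γ = β.z γ := by rw [u, z, β.z_eq_u]
  simp only [extendedAction, torusCoordinates, affineAction]
  rw [← Complex.exp_add, hu]
  congr 1
  field_simp
  ring

/-- `U(F)_ℤ` acts through a discrete group of translations. -/
theorem exists_le_norm_w (Γ : Subgroup L.unitaryGroup) :
    ∃ ε : ℝ, 0 < ε ∧ ∀ t ∈ F.centre Γ, β.w t ≠ 0 → ε ≤ ‖β.w t‖ := by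
  obtain ⟨x, hx, hx'⟩ := exists_mem_lattice (L := L) (β.basis.coord last) (by
    intro h
    have := LinearMap.congr_fun h (β.basis last)
    simp at this)
  obtain ⟨e, he⟩ := L.free
  obtain ⟨i, hi⟩ : ∃ i, e.repr (β.basis first) i ≠ 0 := by
    by_contra! h
    exact β.basis.ne_zero first (e.ext_elem fun i => by simp [h i])
  have hint : ∀ m ∈ L.lattice, IsIntegral ℤ (e.repr m i) := by
    intro m hm
    rw [he] at hm
    induction hm using Submodule.span_induction with
    | mem m hm =>
      obtain ⟨j, rfl⟩ := hm
      rw [Module.Basis.repr_self, Finsupp.single_apply]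
      split_ifs
      · exact isIntegral_one
      · exact isIntegral_zero
    | zero => simpa using isIntegral_zero
    | add m m' _ _ h h' => simpa using h.add h'
    | smul r m _ h =>
      have : e.repr (r • m) i = (r : K) * e.repr m i := by
        rw [← algebraMap_smul K r m, map_smul, Finsupp.smul_apply]; rfl
      rw [this]
      exact (NumberField.RingOfIntegers.isIntegral_coe r).mul h
  set d : K := β.basis.repr x last * e.repr (β.basis first) i with hd
  have hd0 : d ≠ 0 := mul_ne_zero hx' hi
  have hd1 : 0 < ‖𝕂.toComplex d‖ := by simpa using hd0
  refine ⟨1 / ‖𝕂.toComplex d‖, by positivity, fun t ht hw => ?_⟩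
  have hmem := L.lattice.sub_mem ((toLinear_mem_lattice t).mpr hx) hx
  rw [β.toLinear_centre ht, add_sub_cancel_left] at hmem
  have h := hint _ hmem
  rw [map_smul, Finsupp.smul_apply, smul_eq_mul, mul_assoc, ← hd] at h
  have hκ : β.coeff t first last ≠ 0 := by
    intro h0; exact hw (by rw [w, h0, map_zero])
  have := 𝕂.one_le_norm h (mul_ne_zero hκ hd0)
  rw [map_mul, norm_mul] at this
  rw [div_le_iff₀ hd1]
  exact this

/-- `U(F)_ℤ` acts by integral multiples of `σ`. -/
theorem exists_int_mul_period {t : F.stabilizer Γ} (ht : t ∈ F.centre Γ) :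
    ∃ m : ℤ, β.w t = m * β.period Γ := by
  have ha := β.a_ne_zero
  have hIa : Complex.I * β.a ≠ 0 := mul_ne_zero Complex.I_ne_zero ha
  have w_one : β.w (1 : F.stabilizer Γ) = 0 := by simp [w, coeff]
  let H : AddSubgroup ℝ :=
    { carrier := {x | ∃ γ ∈ F.centre Γ, β.w γ = Complex.I * β.a * x}
      zero_mem' := ⟨1, one_mem _, by simp [w_one]⟩
      add_mem' := by
        rintro x y ⟨γ, hγ, hx⟩ ⟨γ', hγ', hy⟩
        exact ⟨γ * γ', mul_mem hγ hγ', by rw [β.w_mul hγ hγ', hx, hy]; push_cast; ring⟩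
      neg_mem' := by
        rintro x ⟨γ, hγ, hx⟩
        refine ⟨γ⁻¹, inv_mem hγ, ?_⟩
        have := β.w_mul hγ (inv_mem hγ)
        rw [mul_inv_cancel, w_one, hx] at this
        push_cast
        linear_combination -this }
  obtain ⟨x, hx⟩ := β.w_centre ht
  have hxH : x ∈ H := ⟨t, ht, hx⟩
  by_cases hbot : H = ⊥
  · rw [hbot, AddSubgroup.mem_bot] at hxH
    exact ⟨0, by rw [hx, hxH]; simp⟩
  · obtain ⟨ε, hε, h⟩ := β.exists_le_norm_w Γ
    have hna : 0 < ‖Complex.I * β.a‖ := by simpa using ha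
    obtain ⟨b, hb⟩ := AddSubgroup.exists_isLeast_pos hbot (a := ε / ‖Complex.I * β.a‖)
      (by positivity) (by
        rw [Set.disjoint_left]
        rintro r ⟨γ, hγ, hr⟩ ⟨hr0, hr1⟩
        have := h γ hγ (by rw [hr]; exact mul_ne_zero hIa (by exact_mod_cast hr0.ne'))
        rw [hr, norm_mul, Complex.norm_real, Real.norm_of_nonneg hr0.le] at this
        rw [lt_div_iff₀ hna] at hr1
        nlinarith)
    have hgen := AddSubgroup.cyclic_of_min hb
    have hinf : sInf {x : ℝ | 0 < x ∧ ∃ γ ∈ F.centre Γ, β.w γ = Complex.I * β.a * x} = b := by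
      have : {x : ℝ | 0 < x ∧ ∃ γ ∈ F.centre Γ, β.w γ = Complex.I * β.a * x} =
          {g : ℝ | g ∈ H ∧ 0 < g} := by
        ext r; exact and_comm
      rw [this]; exact hb.csInf_eq
    rw [hgen] at hxH
    obtain ⟨m, hm⟩ := AddSubgroup.mem_closure_singleton.mp hxH
    refine ⟨m, ?_⟩
    rw [hx, period, hinf, ← hm]
    simp
    ring

theorem extendedAction_mul_centre (γ : F.stabilizer Γ) {t : F.stabilizer Γ}
    (ht : t ∈ F.centre Γ) : β.extendedAction (γ * t) = β.extendedAction γ := by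
  have hcol : ∀ i j, β.coeff (γ * t) i j = β.coeff γ i j +
      β.coeff t first last * β.basis.repr (β.basis j) last * β.coeff γ i first := by
    intro i j
    simp only [coeff]
    rw [map_mul, LinearEquiv.mul_apply, β.toLinear_centre ht]
    simp [coeff]
  have hfirst : ∀ i, i ≠ first → β.coeff γ i first = 0 := by
    intro i hi
    rw [coeff, β.toLinear_first]; simp [hi.symm]
  have hv : β.v (γ * t) = β.v γ := by ext j; simp [v, hcol]
  have hX : β.X (γ * t) = β.X γ := by ext i j; simp [X, hcol]
  have hy : β.y (γ * t) = β.y γ := by ext i; simp [y, hcol, hfirst]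
  have hz : β.z (γ * t) = β.z γ := by simp [z, hcol, hfirst]
  have hw : β.w (γ * t) = β.w γ + β.w t * β.z γ := by
    simp [w, z, hcol, β.z_eq_u]
  funext p
  refine Prod.ext ?_ (by simp only [extendedAction, hX, hy, hz])
  simp only [extendedAction, hv, hz, hw]
  obtain ⟨m, hm⟩ := β.exists_int_mul_period ht
  have hz0 := β.z_ne_zero γ
  have : 2 * Real.pi * Complex.I / β.period Γ *
      ((β.v γ ⬝ᵥ p.2 + (β.w γ + β.w t * β.z γ)) / β.z γ) =
      2 * Real.pi * Complex.I / β.period Γ * ((β.v γ ⬝ᵥ p.2 + β.w γ) / β.z γ) +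
      2 * Real.pi * Complex.I / β.period Γ * β.w t := by
    field_simp
    ring
  rw [this, Complex.exp_add]
  have h1 : Complex.exp (2 * Real.pi * Complex.I / β.period Γ * β.w t) = 1 := by
    rw [hm]
    by_cases h0 : β.period Γ = 0
    · simp [h0]
    · rw [Complex.exp_eq_one_iff]
      exact ⟨m, by field_simp⟩
  rw [h1, mul_one]

/-- The action of `G(F) = N(F)_ℤ / U(F)_ℤ` on the partial compactification `ℂ × ℂⁿ⁻¹`. -/
def action (β : F.AdaptedBasis) (g : F.boundaryGroup Γ) :
    ℂ × (Fin (n - 1) → ℂ) → ℂ × (Fin (n - 1) → ℂ) :=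
  Quotient.liftOn' g β.extendedAction (by
    intro γ γ' h
    rw [QuotientGroup.leftRel_apply] at h
    rw [← β.extendedAction_mul_centre γ h, mul_inv_cancel_left])

/-- The map which `g ∈ G(F)` induces on the tangent space at the point `p` (fixed by `g`). -/
def tangentMap (β : F.AdaptedBasis) (g : F.boundaryGroup Γ) (p : ℂ × (Fin (n - 1) → ℂ)) :
    Module.End ℂ (ℂ × (Fin (n - 1) → ℂ)) :=
  (fderiv ℂ (β.action g) p).toLinearMap

end AdaptedBasis
end Cusp
end HermitianLattice

/-- A quasi-reflection: a linear map of finite order whose fixed space is a hyperplane. -/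
def IsQuasiReflection {V : Type*} [AddCommGroup V] [Module ℂ V] (A : Module.End ℂ V) : Prop :=
  IsOfFinOrder A ∧ Module.finrank ℂ (LinearMap.ker (A - 1)) + 1 = Module.finrank ℂ V

/-- The least `e ≥ 0` with `ζ ^ e = μ`. -/
def exponent (ζ μ : ℂ) : ℕ := sInf {e : ℕ | ζ ^ e = μ}

open Classical in
/-- The modified Reid–Tai sum `Σ'(g^f) = {f aₙ / k} + ∑_{i < n} {f aᵢ / (l k)}`, where `A` is the
action of `g` on the tangent space, `A ^ k` is a quasi-reflection of order `l`, `ζ` is a primitive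
`lk`-th root of unity, and `ζ ^ aᵢ`, `0 ≤ aᵢ < lk`, are the eigenvalues of `A` with multiplicity;
`ζ ^ aₙ` is the one which belongs to the eigenvalue `≠ 1` of `A ^ k`. -/
def sigmaPrime {V : Type*} [AddCommGroup V] [Module ℂ V] [FiniteDimensional ℂ V]
    (A : Module.End ℂ V) (k : ℕ) (ζ : ℂ) (f : ℕ) : ℚ :=
  (A.charpoly.roots.map fun μ : ℂ =>
    if μ ^ k = 1 then Int.fract ((f * exponent ζ μ : ℚ) / (orderOf (A ^ k) * k))
    else Int.fract ((f * exponent ζ μ : ℚ) / k)).sum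

end BallQuotient

end

/-! At a boundary point fixed by `g` the tangent action `A` is block diagonal: a multiplier on the
normal direction `θ`, and `P = z⁻¹X` on `ℂⁿ⁻¹`. The matrix `P` comes from one over `K`, so its
determinant and the traces of its powers lie in `K`. Since `D < -3`, the only roots of unity in `K`
are `±1` (`eq_one_or_eq_neg_one`). The bound comes from the eigenvalues of `P` alone.

Let `T` index the eigenvalues `dᵢ` of `P` with `dᵢ ^ k = 1`. At most one eigenvalue of `P` is left
out. If one is, comparing traces puts it in `K`, and it must be `-1` with `k` odd
(`prod_mem_of_unique`). If none is, then `P ^ k = 1`, and an even `k` would make `A ^ k` trivial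
(`tangentMap_pow_eq_one`), so `k` is odd again. In both cases `∏_T dᵢ` is a `k`-th root of unity in
`K` with `k` odd, hence equal to `1`.

The fractional parts attached to the `dᵢ ^ f`, `i ∈ T`, therefore add up to an integer
(`one_le_sum_fract`), and the other summands of `Σ'` are nonnegative. It remains to see that some
`dᵢ ^ f` differs from `1`. Otherwise `P ^ (2f) = 1`, so `A ^ (2f) = 1`, and `A ^ gcd(k, 2f)` is a
quasi-reflection (`pow_gcd`). As `k` is odd, this gcd is `gcd(k, f) ≤ f < k`, against the minimality
of `k`. -/

noncomputable section

namespace BallQuotient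

open Module

/-! ### Diagonal endomorphisms and quasi-reflections -/

section Diagonal

variable {V : Type*} [AddCommGroup V] [Module ℂ V]

/-- `A` is annihilated by some `X ^ m - 1`, which is separable in characteristic zero. Hence `A` is
semisimple, its eigenvectors span over `ℂ`, and a basis can be extracted from them. -/
theorem exists_eigenbasis [FiniteDimensional ℂ V] {A : End ℂ V} (hA : IsOfFinOrder A) {ι : Type*} [Fintype ι]
    (hι : Fintype.card ι = finrank ℂ V) :
    ∃ (b : Basis ι ℂ V) (d : ι → ℂ), ∀ i, A (b i) = d i • b i := by
  obtain ⟨m, hm, h1⟩ := isOfFinOrder_iff_pow_eq_one.mp hA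
  have hss : A.IsSemisimple := by
    refine End.isSemisimple_of_squarefree_aeval_eq_zero (p := Polynomial.X ^ m - 1)
      (Polynomial.X_pow_sub_one_separable_iff.mpr ?_).squarefree (by simp [h1])
    exact_mod_cast hm.ne'
  have htop := hss.iSup_eigenspace_eq_top
  let s : Set V := {x | ∃ μ : ℂ, A x = μ • x}
  have hs : ⊤ ≤ Submodule.span ℂ s := by
    rw [← htop, iSup_le_iff]
    intro μ x hx
    exact Submodule.subset_span ⟨μ, End.mem_eigenspace_iff.mp hx⟩
  let b := Basis.ofSpan hs
  have : Fintype _ := FiniteDimensional.fintypeBasisIndex b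
  let e := Fintype.equivOfCardEq ((finrank_eq_card_basis b).symm.trans hι.symm)
  have h : ∀ i, ∃ μ : ℂ, A (b.reindex e i) = μ • b.reindex e i := by
    intro i
    have : b.reindex e i ∈ s := Basis.ofSpan_subset hs ⟨e.symm i, by simp [b]⟩
    exact this
  choose d hd using h
  exact ⟨b.reindex e, d, hd⟩

variable {ι : Type*}

theorem pow_apply_basis {A : End ℂ V} {b : Basis ι ℂ V} {d : ι → ℂ}
    (h : ∀ i, A (b i) = d i • b i) (m : ℕ) (i : ι) : (A ^ m) (b i) = d i ^ m • b i := by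
  induction m with
  | zero => simp
  | succ m ih => rw [pow_succ, End.mul_apply, h, map_smul, ih, smul_smul, pow_succ']

variable [Fintype ι]

theorem toMatrix_eq_diagonal [DecidableEq ι] {A : End ℂ V} (b : Basis ι ℂ V) {d : ι → ℂ}
    (h : ∀ i, A (b i) = d i • b i) : LinearMap.toMatrix b b A = Matrix.diagonal d := by
  ext i j
  rw [LinearMap.toMatrix_apply, h, map_smul, Basis.repr_self, Matrix.diagonal_apply]
  rcases eq_or_ne i j with rfl | hij <;> simp [*, Ne.symm]

theorem det_eq_prod_of_basis {A : End ℂ V} (b : Basis ι ℂ V) {d : ι → ℂ}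
    (h : ∀ i, A (b i) = d i • b i) : LinearMap.det A = ∏ i, d i := by
  classical
  rw [← LinearMap.det_toMatrix b, toMatrix_eq_diagonal b h, Matrix.det_diagonal]

theorem trace_eq_sum_of_basis {A : End ℂ V} (b : Basis ι ℂ V) {d : ι → ℂ}
    (h : ∀ i, A (b i) = d i • b i) : LinearMap.trace ℂ V A = ∑ i, d i := by
  classical
  rw [LinearMap.trace_eq_matrix_trace ℂ b, toMatrix_eq_diagonal b h, Matrix.trace_diagonal]

variable [FiniteDimensional ℂ V]

theorem finrank_ker_add_card {A : End ℂ V} (b : Basis ι ℂ V) {d : ι → ℂ}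
    (h : ∀ i, A (b i) = d i • b i) [DecidablePred fun i => d i ≠ 0] :
    finrank ℂ (LinearMap.ker A) + Fintype.card {i // d i ≠ 0} = finrank ℂ V := by
  classical
  have := (LinearMap.toMatrix b b A).rank_eq_finrank_range_toLin b b
  rw [Matrix.toLin_toMatrix, toMatrix_eq_diagonal b h, Matrix.rank_diagonal] at this
  rw [← LinearMap.finrank_range_add_finrank_ker A, ← this, add_comm]
  congr!

theorem roots_charpoly_of_basis {A : End ℂ V} (b : Basis ι ℂ V) {d : ι → ℂ}
    (h : ∀ i, A (b i) = d i • b i) : A.charpoly.roots = Finset.univ.val.map d := by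
  classical
  rw [← LinearMap.charpoly_toMatrix A b, toMatrix_eq_diagonal b h, Matrix.charpoly_diagonal,
    Polynomial.roots_prod _ _ (by
      exact Finset.prod_ne_zero_iff.mpr fun i _ => Polynomial.X_sub_C_ne_zero _)]
  simp

/-- In the eigenbasis `A ^ k - 1` is diagonal with entries `d i ^ k - 1`, and the codimension of its
kernel counts the nonzero ones. -/
theorem IsQuasiReflection.exists_unique {A : End ℂ V} {k : ℕ} (hk : IsQuasiReflection (A ^ k))
    (b : Basis ι ℂ V) {d : ι → ℂ} (h : ∀ i, A (b i) = d i • b i) :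
    ∃ i₀, ∀ i, d i ^ k ≠ 1 ↔ i = i₀ := by
  classical
  have h1 : ∀ i, (A ^ k - 1) (b i) = (d i ^ k - 1) • b i := fun i => by
    rw [LinearMap.sub_apply, pow_apply_basis h, sub_smul, one_smul, End.one_apply]
  have h2 := finrank_ker_add_card b h1
  have h3 : Fintype.card {i // d i ^ k - 1 ≠ 0} = 1 := by have := hk.2; omega
  obtain ⟨⟨i₀, hi₀⟩, hu⟩ := Fintype.card_eq_one_iff.mp h3
  refine ⟨i₀, fun i => ⟨fun hi => ?_, ?_⟩⟩
  · exact congrArg Subtype.val (hu ⟨i, sub_ne_zero.mpr hi⟩)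
  · rintro rfl; exact sub_ne_zero.mp hi₀

end Diagonal

theorem not_isQuasiReflection_one {V : Type*} [AddCommGroup V] [Module ℂ V] :
    ¬ IsQuasiReflection (1 : End ℂ V) := by
  rintro ⟨-, h⟩
  rw [sub_self, LinearMap.ker_zero, finrank_top] at h
  omega

/-- If `A ^ m = 1` and `d = gcd k m`, then `A ^ d` and `A ^ k` have the same fixed space. -/
theorem IsQuasiReflection.pow_gcd {V : Type*} [AddCommGroup V] [Module ℂ V] {A : End ℂ V}
    {m k : ℕ} (hk : IsQuasiReflection (A ^ k)) (hm0 : m ≠ 0) (hm : A ^ m = 1) :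
    IsQuasiReflection (A ^ Nat.gcd k m) := by
  have hfix : ∀ (j : ℕ) (x : V), x ∈ LinearMap.ker (A ^ j - 1) ↔ Function.IsPeriodicPt A j x := by
    intro j x
    rw [LinearMap.mem_ker, LinearMap.sub_apply, End.one_apply, sub_eq_zero, End.pow_apply]
    rfl
  -- A vector fixed by `A ^ j` is a periodic point of period `j`, and the periods of a point are
  -- closed under gcd. Every vector has period `m`.
  have hker : LinearMap.ker (A ^ Nat.gcd k m - 1) = LinearMap.ker (A ^ k - 1) := by
    ext x
    rw [hfix, hfix]
    refine ⟨fun h => h.trans_dvd (Nat.gcd_dvd_left k m), fun h => h.gcd ((hfix m x).mp ?_)⟩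
    rw [hm, sub_self]; simp
  refine ⟨?_, by rw [hker]; exact hk.2⟩
  exact (isOfFinOrder_iff_pow_eq_one.mpr ⟨m, Nat.pos_of_ne_zero hm0, hm⟩).pow

end BallQuotient

namespace BallQuotient

/-! ### Units and roots of unity of `K` -/

namespace ImaginaryQuadraticField

variable {D : ℤ} {K : Type*} [Field K] [NumberField K] [StarRing K]

/-- The conjugate of `δ` is again a square root of `D`; were it `δ` itself, `δ` would be rational
with negative square. -/
theorem exists_sqrt_star_eq_neg (𝕂 : ImaginaryQuadraticField D K) :
    ∃ δ : K, δ ^ 2 = D ∧ star δ = -δ := by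
  obtain ⟨δ, hδ⟩ := 𝕂.exists_sqrt
  refine ⟨δ, hδ, ?_⟩
  have h : star δ ^ 2 = δ ^ 2 := by
    rw [← star_pow, hδ]
    exact_mod_cast 𝕂.star_ratCast D
  refine (sq_eq_sq_iff_eq_or_eq_neg.mp h).resolve_left fun h' => ?_
  obtain ⟨q, rfl⟩ := 𝕂.exists_rat_of_star_eq h'
  have h2 : q ^ 2 = D := by exact_mod_cast hδ
  have h3 : (D : ℚ) < 0 := by exact_mod_cast 𝕂.neg
  nlinarith [sq_nonneg q]

theorem exists_int_of_star_eq (𝕂 : ImaginaryQuadraticField D K) {t : K} (ht : star t = t)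
    (hi : IsIntegral ℤ t) : ∃ m : ℤ, t = m := by
  obtain ⟨q, rfl⟩ := 𝕂.exists_rat_of_star_eq ht
  have h : IsIntegral ℤ (algebraMap ℚ K q) := by rwa [eq_ratCast]
  obtain ⟨m, rfl⟩ := IsIntegrallyClosed.isIntegral_iff.mp
    ((isIntegral_algebraMap_iff (algebraMap ℚ K).injective).mp h)
  exact ⟨m, by simp⟩

/-- The units of an imaginary quadratic field other than `ℚ(i)` and `ℚ(√-3)` are `± 1`. -/
theorem eq_one_or_eq_neg_one (𝕂 : ImaginaryQuadraticField D K) (hD : D < -3) {x y : K}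
    (hx : IsIntegral ℤ x) (hy : IsIntegral ℤ y) (h : x * y = 1) : x = 1 ∨ x = -1 := by
  have h1 := 𝕂.mul_star_eq_one hx hy h
  have hs : IsIntegral ℤ (star x) := hx.map (starRingEnd K).toIntAlgHom
  obtain ⟨δ, hδ, hδs⟩ := 𝕂.exists_sqrt_star_eq_neg
  have hδi : IsIntegral ℤ δ := by
    refine IsIntegral.of_pow (n := 2) (by norm_num) ?_
    rw [hδ]; exact isIntegral_algebraMap (x := D)
  obtain ⟨m, hm⟩ := 𝕂.exists_int_of_star_eq (t := x + star x) (by simp [add_comm]) (hx.add hs)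
  -- The factor `δ` turns the anti-invariant `x - star x` into an invariant integral element, hence
  -- a rational integer.
  obtain ⟨r, hr⟩ := 𝕂.exists_int_of_star_eq (t := (x - star x) * δ)
    (by simp only [star_mul, star_sub, star_star, hδs]; ring) ((hx.sub hs).mul hδi)
  -- With `x * star x = 1` this is `(x - x̄)² = (x + x̄)² - 4` times `D`. As `D < 0`, it bounds the
  -- trace: `|m| ≤ 2`.
  have hrm : r ^ 2 = (m ^ 2 - 4) * D := by
    have : (r : K) ^ 2 = ((m : K) ^ 2 - 4) * D := by
      rw [← hr, ← hm, ← hδ]; linear_combination (-4 * δ ^ 2) * h1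
    exact_mod_cast this
  have hsq : ∀ s : ℤ, s * s ∣ D → s * s = 1 := fun s hs =>
    Int.isUnit_mul_self (𝕂.squarefree s hs)
  have hx2 : x * x = m * x - 1 := by rw [← hm]; linear_combination -h1
  have hm2 : m ^ 2 ≤ 4 := by nlinarith [sq_nonneg r]
  have hm_lower : -2 ≤ m := by nlinarith
  have hm_upper : m ≤ 2 := by nlinarith
  -- For squarefree `D`, traces `±1` would force `D = -3` and trace `0` would force `D = -1`.
  have hunit : m = 2 ∨ m = -2 := by
    by_contra! hne
    have hm_lower : -1 ≤ m := by omega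
    have hm_upper : m ≤ 1 := by omega
    have hthree : r ^ 2 = -3 * D → False := by
      intro hr3
      have : (3 : ℤ) ∣ r := Int.prime_three.dvd_of_dvd_pow (n := 2) ⟨-D, by rw [hr3]; ring⟩
      obtain ⟨s, rfl⟩ := this
      have := hsq s ⟨-3, by nlinarith⟩
      nlinarith
    interval_cases m
    · exact hthree (by rw [hrm]; norm_num)
    · have : (2 : ℤ) ∣ r := Int.prime_two.dvd_of_dvd_pow (n := 2) ⟨-2 * D, by rw [hrm]; ring⟩
      obtain ⟨s, rfl⟩ := this
      have := hsq s ⟨-1, by nlinarith⟩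
      nlinarith
    · exact hthree (by rw [hrm]; norm_num)
  rcases hunit with rfl | rfl
  · left
    -- Trace `2` and norm `1` give the characteristic polynomial `(X - 1)²`.
    have : (x - 1) ^ 2 = 0 := by push_cast at hx2; linear_combination hx2
    exact sub_eq_zero.mp (pow_eq_zero_iff (two_ne_zero) |>.mp this)
  · right
    have : (x + 1) ^ 2 = 0 := by push_cast at hx2; linear_combination hx2
    exact eq_neg_of_add_eq_zero_left (pow_eq_zero_iff (two_ne_zero) |>.mp this)

theorem eq_one_or_eq_neg_one_of_pow (𝕂 : ImaginaryQuadraticField D K) (hD : D < -3) {x : K} {N : ℕ}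
    (hN : N ≠ 0) (hx : x ^ N = 1) : x = 1 ∨ x = -1 := by
  have hi : IsIntegral ℤ x := .of_pow (Nat.pos_of_ne_zero hN) (hx ▸ isIntegral_one)
  refine 𝕂.eq_one_or_eq_neg_one hD hi (hi.pow (N - 1)) ?_
  rw [mul_pow_sub_one hN, hx]

end ImaginaryQuadraticField

/-! ### Block matrices of `N(F)_ℤ` and the derivative at the boundary -/

namespace HermitianLattice.Cusp.AdaptedBasis

variable {D : ℤ} {K : Type*} [Field K] [NumberField K] [StarRing K]
  {𝕂 : ImaginaryQuadraticField D K} {n : ℕ} {M : Type*} [AddCommGroup M] [Module K M]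
  [Module (𝓞 K) M] {L : HermitianLattice 𝕂 n M} {F : L.Cusp} {Γ : Subgroup L.unitaryGroup}
  (β : F.AdaptedBasis)

theorem coeff_mul (γ γ' : F.stabilizer Γ) (i j : CuspIndex n) :
    β.coeff (γ * γ') i j = ∑ m, β.coeff γ i m * β.coeff γ' m j := by
  have h := congrArg (fun x => β.basis.repr (F.toLinear Γ γ x) i)
    (β.basis.sum_repr (F.toLinear Γ γ' (β.basis j)))
  simp only [map_sum, map_smul, Finsupp.coe_finsetSum, Finset.sum_apply, Finsupp.smul_apply,
    smul_eq_mul] at h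
  rw [coeff, map_mul, LinearEquiv.mul_apply, ← h]
  exact Finset.sum_congr rfl fun m _ => mul_comm _ _

theorem coeff_first (γ : F.stabilizer Γ) {i : CuspIndex n} (hi : i ≠ first) :
    β.coeff γ i first = 0 := by
  rw [coeff, β.toLinear_first]; simp [hi.symm]

theorem coeff_last_mid (γ : F.stabilizer Γ) (j : Fin (n - 1)) : β.coeff γ last (mid j) = 0 := by
  rw [coeff, β.last_toLinear]; simp

theorem z_mul (γ γ' : F.stabilizer Γ) : β.z (γ * γ') = β.z γ * β.z γ' := by
  simp [z, coeff_mul, coeff_last_mid, coeff_first]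

theorem X_mul (γ γ' : F.stabilizer Γ) : β.X (γ * γ') = β.X γ * β.X γ' := by
  ext i j
  simp [X, coeff_mul, coeff_last_mid, coeff_first, Matrix.mul_apply]

theorem y_mul (γ γ' : F.stabilizer Γ) :
    β.y (γ * γ') = (β.X γ).mulVec (β.y γ') + β.z γ' • β.y γ := by
  ext i
  simp [X, y, z, coeff_mul, coeff_first, Matrix.mulVec, dotProduct, mul_comm]

theorem v_mul (γ γ' : F.stabilizer Γ) :
    β.v (γ * γ') = β.u γ • β.v γ' + Matrix.vecMul (β.v γ) (β.X γ') := by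
  ext i
  simp [X, v, u, coeff_mul, coeff_last_mid, Matrix.vecMul, dotProduct]

theorem corner_mul (γ γ' : F.stabilizer Γ) :
    β.w (γ * γ') = β.u γ * β.w γ' + β.v γ ⬝ᵥ β.y γ' + β.w γ * β.z γ' := by
  simp [w, v, u, y, z, coeff_mul, dotProduct, add_assoc]

/-- The linear part `z⁻¹ X` of the action on the boundary component. -/
def linearPart (γ : F.stabilizer Γ) : Matrix (Fin (n - 1)) (Fin (n - 1)) ℂ :=
  (β.z γ)⁻¹ • β.X γ

/-- The linear part, as a matrix with entries in `K`. -/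
def rationalLinearPart (γ : F.stabilizer Γ) : Matrix (Fin (n - 1)) (Fin (n - 1)) K :=
  (β.coeff γ last last)⁻¹ • Matrix.of fun i j => β.coeff γ (mid i) (mid j)

/-- The multiplier of the action on the normal direction to the boundary. -/
def multiplier (γ : F.stabilizer Γ) (p : Fin (n - 1) → ℂ) : ℂ :=
  Complex.exp (2 * Real.pi * Complex.I / β.period Γ * ((β.v γ ⬝ᵥ p + β.w γ) / β.z γ))

theorem map_rationalLinearPart (γ : F.stabilizer Γ) :
    (β.rationalLinearPart γ).map 𝕂.toComplex = β.linearPart γ := by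
  ext i j
  simp [rationalLinearPart, linearPart, z, X]

theorem linearPart_mul (γ γ' : F.stabilizer Γ) :
    β.linearPart (γ * γ') = β.linearPart γ * β.linearPart γ' := by
  simp only [linearPart, z_mul, X_mul, mul_inv, Matrix.smul_mul, Matrix.mul_smul, smul_smul,
    mul_comm]

theorem mem_range_det_linearPart (γ : F.stabilizer Γ) :
    ∃ x, 𝕂.toComplex x = (β.linearPart γ).det :=
  ⟨(β.rationalLinearPart γ).det, by
    rw [RingHom.map_det, ← map_rationalLinearPart, RingHom.mapMatrix_apply]⟩

/-- Power sums of the eigenvalues of `P` are thus elements of `K`, although the eigenvalues need not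
be. -/
theorem mem_range_trace_linearPart_pow (γ : F.stabilizer Γ) (m : ℕ) :
    ∃ x, 𝕂.toComplex x = (β.linearPart γ ^ m).trace := by
  refine ⟨(β.rationalLinearPart γ ^ m).trace, ?_⟩
  rw [← map_rationalLinearPart, ← RingHom.mapMatrix_apply, ← map_pow, RingHom.mapMatrix_apply,
    AddMonoidHom.map_trace]

/-- The `θ`-component is `θ` times a function of `w`. At `θ = 0` the derivative of that function is
multiplied by zero, so no off-diagonal block survives. -/
theorem hasFDerivAt_extendedAction (γ : F.stabilizer Γ) (p : Fin (n - 1) → ℂ) :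
    HasFDerivAt (β.extendedAction γ)
      ((β.multiplier γ p • ContinuousLinearMap.id ℂ ℂ).prodMap
        (Matrix.toLin' (β.linearPart γ)).toContinuousLinearMap) (0, p) := by
  have hE : DifferentiableAt ℂ (fun q : ℂ × (Fin (n - 1) → ℂ) => β.multiplier γ q.2) (0, p) := by
    simp only [multiplier, dotProduct]
    fun_prop
  have h1 := (hasFDerivAt_fst (𝕜 := ℂ) (p := ((0 : ℂ), p))).mul hE.hasFDerivAt
  have h2 := (((Matrix.toLin' (β.linearPart γ)).toContinuousLinearMap.comp
    (ContinuousLinearMap.snd ℂ ℂ (Fin (n - 1) → ℂ))).hasFDerivAt (x := ((0 : ℂ), p))).add_const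
      ((β.z γ)⁻¹ • β.y γ)
  refine ((h1.prodMk h2).congr_fderiv ?_).congr_of_eventuallyEq (.of_forall fun q => ?_)
  · ext x <;> simp
  · refine Prod.ext rfl ?_
    simp [extendedAction, linearPart]

theorem tangentMap_mk (γ : F.stabilizer Γ) [IsScalarTower (𝓞 K) K M] (p : Fin (n - 1) → ℂ) :
    β.tangentMap (QuotientGroup.mk γ : F.boundaryGroup Γ) (0, p) =
      LinearMap.prodMap (β.multiplier γ p • LinearMap.id) (Matrix.toLin' (β.linearPart γ)) := by
  have h : β.action (QuotientGroup.mk γ : F.boundaryGroup Γ) = β.extendedAction γ := rfl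
  rw [tangentMap, h, (β.hasFDerivAt_extendedAction γ p).fderiv]
  rfl

/-- An element of `N(F)_ℤ` with `z = 1` and `X = 1` which fixes a boundary point lies in
`U(F)_ℤ`. -/
theorem mem_centre_of_fixed {γ : F.stabilizer Γ} (hz : β.coeff γ last last = 1)
    (hX : β.linearPart γ = 1) {p : Fin (n - 1) → ℂ}
    (hp : β.extendedAction γ (0, p) = (0, p)) : γ ∈ F.centre Γ := by
  have hz1 : β.z γ = 1 := by rw [z, hz, map_one]
  have hX1 : β.X γ = 1 := by simpa [linearPart, hz1] using hX
  -- With trivial linear part, `γ` acts on the boundary as translation by `y`, and it has a fixed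
  -- point.
  have hy : β.y γ = 0 := by
    have := congrArg Prod.snd hp
    simpa [extendedAction, hz1, hX1] using this
  have hX' : ∀ i j, β.coeff γ (mid i) (mid j) = if i = j then 1 else 0 := by
    intro i j
    apply 𝕂.toComplex.injective
    have := congrFun (congrFun hX1 i) j
    rw [Matrix.one_apply] at this
    rw [apply_ite 𝕂.toComplex, map_one, map_zero]
    exact this
  have hy' : ∀ i, β.coeff γ (mid i) last = 0 := fun i =>
    𝕂.toComplex.injective (by rw [map_zero]; exact congrFun hy i)
  have hexp : ∀ j, F.toLinear Γ γ (β.basis j) = ∑ m, β.coeff γ m j • β.basis m := fun j =>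
    (β.basis.sum_repr _).symm
  have hlast : F.toLinear Γ γ (β.basis last) =
      β.coeff γ first last • β.basis first + β.basis last := by
    rw [hexp]; simp [hy', hz]
  have hmid : ∀ j, F.toLinear Γ γ (β.basis (mid j)) =
      β.coeff γ first (mid j) • β.basis first + β.basis (mid j) := by
    intro j
    rw [hexp]; simp [hX', coeff_last_mid]
  have hfirst : F.toLinear Γ γ (β.basis first) = β.basis first := by
    have h := β.z_mul_star_u γ
    rw [hz, one_mul, star_eq_iff_star_eq, star_one] at h
    rw [β.toLinear_first, ← h, one_smul]
  -- Invariance of `h(bₙ₊₁, bⱼ) = 0` leaves the conjugate of `vⱼ` times `h(bₙ₊₁, b₁)`, and the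
  -- latter is nonzero.
  have hv : ∀ j, β.coeff γ first (mid j) = 0 := by
    intro j
    have h := form_toLinear γ (β.basis last) (β.basis (mid j))
    have h0 : L.form (β.basis last) (β.basis (mid j)) = 0 := by
      rw [← L.hermitian, β.form_mid_last, star_zero]
    rw [hlast, hmid] at h
    simp only [map_add, LinearMap.add_apply, map_smulₛₗ, LinearMap.smul_apply,
      β.form_first_first, β.form_first_mid, h0, smul_eq_mul, mul_zero, zero_add, add_zero] at h
    exact (map_eq_zero _).mp ((mul_eq_zero.mp h).resolve_right β.form_last_first_ne)
  intro x hx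
  rw [β.mem_perp_iff] at hx
  rw [← β.basis.sum_repr x]
  simp only [map_sum, map_smul]
  refine Finset.sum_congr rfl fun i _ => ?_
  rcases i with _ | i | _
  · exact congrArg _ hfirst
  · exact congrArg _ ((hmid i).trans (by rw [hv, zero_smul, zero_add]))
  · change β.basis.repr x last • _ = β.basis.repr x last • _
    rw [hx, zero_smul, zero_smul]

theorem coeff_last_last_pow (γ : F.stabilizer Γ) (m : ℕ) :
    β.coeff (γ ^ m) last last = β.coeff γ last last ^ m := by
  induction m with
  | zero => simp [coeff]
  | succ m ih => rw [pow_succ, coeff_mul, pow_succ, ← ih]; simp [coeff_first, coeff_last_mid]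

theorem linearPart_pow (γ : F.stabilizer Γ) {m : ℕ} (hm : m ≠ 0) :
    β.linearPart (γ ^ m) = β.linearPart γ ^ m := by
  induction m, Nat.one_le_iff_ne_zero.mpr hm using Nat.le_induction with
  | base => simp
  | succ m hm' ih => rw [pow_succ, pow_succ, linearPart_mul, ih (by omega)]

/-! ### The action of `G(F)` and its tangent maps -/

variable [IsScalarTower (𝓞 K) K M]

/-- The exponents of the two multipliers add up because `u = z`: the exponent of `γ'` enters with
the factor `u/z = 1`. -/
theorem extendedAction_mul (γ γ' : F.stabilizer Γ) (p : ℂ × (Fin (n - 1) → ℂ)) :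
    β.extendedAction (γ * γ') p = β.extendedAction γ (β.extendedAction γ' p) := by
  have hz := β.z_ne_zero γ
  have hz' := β.z_ne_zero γ'
  have hu : β.u γ = β.z γ := by rw [u, z, β.z_eq_u]
  refine Prod.ext ?_ ?_
  · simp only [extendedAction, z_mul, v_mul, corner_mul, hu]
    rw [mul_assoc p.1, ← Complex.exp_add, ← mul_add]
    congr 3
    simp only [add_dotProduct, smul_dotProduct, dotProduct_add, dotProduct_smul, smul_eq_mul,
      ← Matrix.dotProduct_mulVec]
    field_simp
    ring
  · simp only [extendedAction, z_mul, X_mul, y_mul, Matrix.mulVec_add, Matrix.mulVec_smul,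
      ← Matrix.mulVec_mulVec, smul_add, smul_smul]
    rw [mul_inv, add_assoc]
    congr 2
    rw [mul_assoc, inv_mul_cancel₀ hz', mul_one]

theorem action_mul (g g' : F.boundaryGroup Γ) : β.action (g * g') = β.action g ∘ β.action g' := by
  induction g using QuotientGroup.induction_on with | H γ
  induction g' using QuotientGroup.induction_on with | H γ'
  exact funext (β.extendedAction_mul γ γ')

theorem action_one : β.action (1 : F.boundaryGroup Γ) = id := by
  change β.extendedAction (1 : F.stabilizer Γ) = id
  have h0 : β.v (1 : F.stabilizer Γ) = 0 := by ext; simp [v, coeff]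
  have h1 : β.w (1 : F.stabilizer Γ) = 0 := by simp [w, coeff]
  have h2 : β.X (1 : F.stabilizer Γ) = 1 := by
    ext i j
    by_cases hij : i = j <;> simp [X, coeff, Matrix.one_apply, Finsupp.single_apply, hij, Ne.symm]
  have h3 : β.y (1 : F.stabilizer Γ) = 0 := by ext; simp [y, coeff]
  have h4 : β.z (1 : F.stabilizer Γ) = 1 := by simp [z, coeff]
  funext p
  simp [extendedAction, h0, h1, h2, h3, h4]

theorem tangentMap_one (p : ℂ × (Fin (n - 1) → ℂ)) :
    β.tangentMap (1 : F.boundaryGroup Γ) p = 1 := by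
  rw [tangentMap, action_one, fderiv_id]; rfl

theorem differentiableAt_action (g : F.boundaryGroup Γ) (p : Fin (n - 1) → ℂ) :
    DifferentiableAt ℂ (β.action g) (0, p) := by
  induction g using QuotientGroup.induction_on with | H γ
  exact (β.hasFDerivAt_extendedAction γ p).differentiableAt

theorem action_pow_eq {g : F.boundaryGroup Γ} {p : ℂ × (Fin (n - 1) → ℂ)}
    (h : β.action g p = p) (m : ℕ) : β.action (g ^ m) p = p := by
  induction m with
  | zero => rw [pow_zero, action_one]; rfl
  | succ m ih => rw [pow_succ, action_mul, Function.comp_apply, h, ih]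

/-- Chain rule at a fixed point; it lets quasi-reflections among the powers of `g` be studied
through one matrix. -/
theorem tangentMap_pow {g : F.boundaryGroup Γ} {p : Fin (n - 1) → ℂ}
    (h : β.action g (0, p) = (0, p)) (m : ℕ) :
    β.tangentMap (g ^ m) (0, p) = β.tangentMap g (0, p) ^ m := by
  induction m with
  | zero => rw [pow_zero, tangentMap_one, pow_zero]
  | succ m ih =>
    have hd : DifferentiableAt ℂ (β.action (g ^ m)) (β.action g (0, p)) := by
      rw [h]; exact β.differentiableAt_action _ _
    rw [pow_succ, pow_succ, ← ih, tangentMap, action_mul,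
      fderiv_comp _ hd (β.differentiableAt_action g p), h]
    rfl

/-- The entry `z` is integral, with inverse the integral entry `z` of `γ⁻¹`, so it is a unit of the
ring of integers. -/
theorem z_eq_one_or_neg_one (hD : D < -3) (γ : F.stabilizer Γ) :
    β.coeff γ last last = 1 ∨ β.coeff γ last last = -1 := by
  refine 𝕂.eq_one_or_eq_neg_one hD (β.isIntegral_z γ) (β.isIntegral_z γ⁻¹) ?_
  have := β.last_toLinear γ (F.toLinear Γ γ⁻¹ (β.basis last))
  rw [toLinear_inv_apply] at this
  simpa [coeff] using this.symm

/-- If `m` is even and `(z⁻¹ X) ^ m = 1`, then `g ^ m` acts trivially. -/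
theorem tangentMap_pow_eq_one (hD : D < -3) {γ : F.stabilizer Γ} {p : Fin (n - 1) → ℂ}
    (hp : β.action (QuotientGroup.mk γ : F.boundaryGroup Γ) (0, p) = (0, p)) {m : ℕ} (hm : Even m)
    (hm0 : m ≠ 0) (h : β.linearPart γ ^ m = 1) :
    β.tangentMap (QuotientGroup.mk γ : F.boundaryGroup Γ) (0, p) ^ m = 1 := by
  -- Evenness of `m` removes the sign of `z = ±1`. Triviality of `P ^ m` then means that the block
  -- `X` of `γ ^ m` is the identity too.
  have hz : β.coeff (γ ^ m) last last = 1 := by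
    rw [coeff_last_last_pow]
    rcases β.z_eq_one_or_neg_one hD γ with h | h <;> rw [h]
    · exact one_pow _
    · exact hm.neg_one_pow
  have hc : γ ^ m ∈ F.centre Γ := by
    refine β.mem_centre_of_fixed hz (by rw [β.linearPart_pow γ hm0, h]) (p := p) ?_
    exact β.action_pow_eq hp m
  rw [← β.tangentMap_pow hp, ← QuotientGroup.mk_pow, (QuotientGroup.eq_one_iff _).mpr hc,
    tangentMap_one]

end HermitianLattice.Cusp.AdaptedBasis

end BallQuotient

/-! ### Fractional parts of exponents -/

namespace BallQuotient

open Module HermitianLattice HermitianLattice.Cusp HermitianLattice.Cusp.AdaptedBasis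

/-- If a product of powers of a root of unity is `1`, the sum of the fractional parts of the
normalised exponents is an integer. -/
theorem one_le_sum_fract {ι : Type*} (T : Finset ι) (e : ι → ℕ) {N : ℕ} {ζ : ℂ}
    (hN : N ≠ 0) (hζ : IsPrimitiveRoot ζ N) (h : ∏ i ∈ T, ζ ^ e i = 1)
    (hne : ∃ i ∈ T, ζ ^ e i ≠ 1) : 1 ≤ ∑ i ∈ T, Int.fract ((e i : ℚ) / N) := by
  have hN' : (N : ℚ) ≠ 0 := by exact_mod_cast hN
  rw [Finset.prod_pow_eq_pow_sum] at h
  obtain ⟨c, hc⟩ := (hζ.pow_eq_one_iff_dvd _).mp h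
  -- `N` divides the sum of the exponents, so the sum of fractional parts differs from an integer by
  -- floors. Being also positive, it is at least `1`.
  have hint : ∑ i ∈ T, Int.fract ((e i : ℚ) / N) =
      ((c - ∑ i ∈ T, ⌊(e i : ℚ) / N⌋ : ℤ) : ℚ) := by
    have h1 : ∑ i ∈ T, (e i : ℚ) / N = c := by
      rw [← Finset.sum_div, div_eq_iff hN', mul_comm]
      exact_mod_cast hc
    simp only [Int.fract, Finset.sum_sub_distrib, h1]
    push_cast; rfl
  have hpos : 0 < ∑ i ∈ T, Int.fract ((e i : ℚ) / N) := by
    obtain ⟨i, hi, hi1⟩ := hne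
    refine Finset.sum_pos' (fun j _ => Int.fract_nonneg _) ⟨i, hi, ?_⟩
    refine (Int.fract_nonneg _).lt_of_ne' fun h0 => hi1 ?_
    obtain ⟨z, hz⟩ := Int.fract_eq_zero_iff.mp h0
    rw [eq_div_iff hN'] at hz
    rw [hζ.pow_eq_one_iff_dvd]
    have : (e i : ℤ) = N * z := by rw [mul_comm]; exact_mod_cast hz.symm
    exact_mod_cast Dvd.intro z this.symm
  rw [hint] at hpos ⊢
  exact_mod_cast hpos

/-- The infimum is attained once some exponent exists; for other `μ` the set is empty and `exponent`
has the default value `0`. -/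
theorem pow_exponent {ζ μ : ℂ} {N : ℕ} [NeZero N] (hζ : IsPrimitiveRoot ζ N) (h : μ ^ N = 1) :
    ζ ^ exponent ζ μ = μ := by
  obtain ⟨i, -, hi⟩ := hζ.eq_pow_of_pow_eq_one h
  exact Nat.sInf_mem (s := {e : ℕ | ζ ^ e = μ}) ⟨i, hi⟩

/-- The modified Reid–Tai sum is at least the contribution of any set of eigenvalues `μ` with
`μ ^ k = 1`. -/
theorem sum_fract_le_sigmaPrime {V : Type*} [AddCommGroup V] [Module ℂ V] [FiniteDimensional ℂ V]
    {A : End ℂ V} {ι : Type*} [Fintype ι] (b : Basis ι ℂ V) {d : ι → ℂ}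
    (h : ∀ i, A (b i) = d i • b i) (k : ℕ) (ζ : ℂ) (f : ℕ) {T : Finset ι}
    (hT : ∀ i ∈ T, d i ^ k = 1) :
    ∑ i ∈ T, Int.fract (((f * exponent ζ (d i) : ℕ) : ℚ) / (orderOf (A ^ k) * k : ℕ)) ≤
      sigmaPrime A k ζ f := by
  classical
  rw [sigmaPrime, roots_charpoly_of_basis b h, Multiset.map_map]
  change _ ≤ Finset.sum Finset.univ _
  -- Indices outside `T`, including the one whose denominator is `k`, contribute nonnegative terms
  -- and are discarded.
  refine le_trans ?_ (Finset.sum_le_sum_of_subset_of_nonneg T.subset_univ fun i _ _ => ?_)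
  · refine Finset.sum_le_sum fun i hi => le_of_eq ?_
    rw [Function.comp_apply, if_pos (hT i hi)]
    push_cast; rfl
  · rw [Function.comp_apply]
    split_ifs <;> exact Int.fract_nonneg _

/-! ### An exceptional eigenvalue of a matrix with traces in `K` -/

section

variable {D : ℤ} {K : Type*} [Field K] [NumberField K] [StarRing K]

/-- Let `P` be a matrix of finite order, with traces of powers and determinant in `K`. If at most
one eigenvalue `μ` of `P` has `μ ^ k ≠ 1`, it is `± 1`, and the product of the others is in `K`. -/
theorem ImaginaryQuadraticField.prod_mem_of_unique (𝕂 : ImaginaryQuadraticField D K) (hD : D < -3)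
    {ι : Type*} [Fintype ι] [DecidableEq ι] {P : Matrix ι ι ℂ}
    (htr : ∀ m, (P ^ m).trace ∈ 𝕂.toComplex.fieldRange) (hdet : P.det ∈ 𝕂.toComplex.fieldRange)
    (b : Basis ι ℂ (ι → ℂ)) {d : ι → ℂ} (h : ∀ i, Matrix.toLin' P (b i) = d i • b i)
    {N : ℕ} (hN : N ≠ 0) (hd : ∀ i, d i ^ N = 1) {k : ℕ} {j : ι} (hj : ∀ i, d i ^ k ≠ 1 ↔ i = j) :
    d j = -1 ∧ Odd k ∧ ∏ i ∈ Finset.univ.erase j, d i ∈ 𝕂.toComplex.fieldRange := by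
  have htr' : ∀ m, ∑ i, d i ^ m ∈ 𝕂.toComplex.fieldRange := by
    intro m
    have := htr m
    rwa [← Matrix.trace_toLin'_eq, Matrix.toLin'_pow,
      trace_eq_sum_of_basis b (pow_apply_basis h m)] at this
  -- In the difference of the `m`-th and `(m + k)`-th power sums every eigenvalue with `μ ^ k = 1`
  -- cancels. The quotient of the cases `m = 1` and `m = 0` is then `d j`.
  have hdiff : ∀ m, d j ^ m * (1 - d j ^ k) ∈ 𝕂.toComplex.fieldRange := by
    intro m
    have : d j ^ m * (1 - d j ^ k) = ∑ i, d i ^ m - ∑ i, d i ^ (m + k) := by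
      rw [← Finset.sum_sub_distrib, Finset.sum_eq_single j]
      · ring
      · intro i _ hij
        have : d i ^ k = 1 := not_not.mp fun hi => hij ((hj i).mp hi)
        rw [pow_add, this, mul_one, sub_self]
      · simp
    rw [this]
    exact sub_mem (htr' _) (htr' _)
  have hne : 1 - d j ^ k ≠ 0 := sub_ne_zero.mpr ((hj j).mpr rfl).symm
  have hdj : d j ∈ 𝕂.toComplex.fieldRange := by
    have := div_mem (hdiff 1) (hdiff 0)
    rwa [pow_one, pow_zero, one_mul, mul_div_cancel_right₀ _ hne] at this
  have hdj1 : d j = -1 := by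
    obtain ⟨x, hx⟩ := hdj
    have hxN : x ^ N = 1 := 𝕂.toComplex.injective (by rw [map_pow, hx, hd, map_one])
    rcases 𝕂.eq_one_or_eq_neg_one_of_pow hD hN hxN with rfl | rfl
    · rw [map_one] at hx
      rw [← hx, one_pow, sub_self] at hne
      exact absurd rfl hne
    · rw [← hx]; simp
  refine ⟨hdj1, ?_, ?_⟩
  · by_contra hk
    rw [hdj1, (Nat.not_odd_iff_even.mp hk).neg_one_pow, sub_self] at hne
    exact hne rfl
  · have hp : ∏ i ∈ Finset.univ.erase j, d i = P.det / d j := by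
      rw [← LinearMap.det_toLin', det_eq_prod_of_basis b h,
        ← Finset.mul_prod_erase _ _ (Finset.mem_univ j), mul_div_cancel_left₀]
      rw [hdj1]; norm_num
    rw [hp]
    exact div_mem hdet hdj

end

end BallQuotient

end

/-! ### The modified Reid–Tai inequality -/

open BallQuotient Module

theorem mainTheorem7 {D : ℤ} {K : Type*} [Field K] [NumberField K] [StarRing K]
    (𝕂 : BallQuotient.ImaginaryQuadraticField D K) (hD : D < -3) (n : ℕ) (hn : 13 ≤ n)
    {M : Type*} [AddCommGroup M] [Module K M] [Module (NumberField.RingOfIntegers K) M]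
    [IsScalarTower (NumberField.RingOfIntegers K) K M]
    (L : BallQuotient.HermitianLattice 𝕂 n M) (Γ : Subgroup L.unitaryGroup) [Γ.FiniteIndex]
    (F : L.Cusp) (β : F.AdaptedBasis) (g : F.boundaryGroup Γ) (w₀ : Fin (n - 1) → ℂ)
    (hfix : β.action g (0, w₀) = (0, w₀)) (k : ℕ)
    (hk : BallQuotient.IsQuasiReflection (β.tangentMap (g ^ k) (0, w₀)))
    (hmin : ∀ j : ℕ, 1 ≤ j → j < k →
      ¬ BallQuotient.IsQuasiReflection (β.tangentMap (g ^ j) (0, w₀)))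
    (ζ : ℂ) (hζ : IsPrimitiveRoot ζ (orderOf (β.tangentMap (g ^ k) (0, w₀)) * k))
    (f : ℕ) (hf : 1 ≤ f) (hfk : f < k) :
    1 ≤ BallQuotient.sigmaPrime (β.tangentMap g (0, w₀)) k ζ f := by
  classical
  obtain ⟨γ, rfl⟩ := QuotientGroup.mk_surjective g
  have hk0 : k ≠ 0 := by omega
  simp only [β.tangentMap_pow hfix] at hk hmin hζ
  have hA := β.tangentMap_mk γ w₀
  have htriv := fun m hm hm0 => β.tangentMap_pow_eq_one hD hfix (m := m) hm hm0
  set A := β.tangentMap (QuotientGroup.mk γ : F.boundaryGroup Γ) (0, w₀)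
  set P := β.linearPart γ
  have hfin : IsOfFinOrder A := hk.1.of_pow hk0
  obtain ⟨N, hN, hAN⟩ := isOfFinOrder_iff_pow_eq_one.mp hfin
  -- The subspace `θ = 0` is stable under `A`, which acts there as `P`; this transfers the finite
  -- order of `A` to `P`.
  have hpow : ∀ (m : ℕ) x, (A ^ m) (0, x) = (0, (Matrix.toLin' P ^ m) x) := by
    intro m x
    induction m with
    | zero => simp
    | succ m ih => rw [pow_succ', pow_succ', End.mul_apply, ih, hA]; simp
  have hPN : Matrix.toLin' P ^ N = 1 := by
    refine LinearMap.ext fun x => ?_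
    have := hpow N x
    rw [hAN] at this
    exact (congrArg Prod.snd this).symm
  obtain ⟨b, d, hb⟩ := exists_eigenbasis (isOfFinOrder_iff_pow_eq_one.mpr ⟨N, hN, hPN⟩)
    (ι := Fin (n - 1)) (by simp)
  have hdN : ∀ i, d i ^ N = 1 := by
    intro i
    have := pow_apply_basis hb N i
    rw [hPN, End.one_apply] at this
    by_contra hne
    have h0 : (d i ^ N - 1) • b i = 0 := by rw [sub_smul, ← this, one_smul, sub_self]
    exact (smul_ne_zero (sub_ne_zero.mpr hne) (b.ne_zero i)) h0
  have hPpow : ∀ m : ℕ, (∀ i, d i ^ m = 1) → P ^ m = 1 := by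
    intro m hm
    apply Matrix.toLin'.injective
    rw [Matrix.toLin'_pow, Matrix.toLin'_one]
    refine b.ext fun i => ?_
    rw [pow_apply_basis hb, hm, one_smul, LinearMap.id_apply]
  let B := (Basis.singleton Unit ℂ).prod b
  let e : Unit ⊕ Fin (n - 1) → ℂ := Sum.elim (fun _ => β.multiplier γ w₀) d
  have hB : ∀ i, A (B i) = e i • B i := by
    rintro (i | i)
    · rw [hA]; simp [B, e]
    · rw [hA]; simpa [B, e] using hb i
  -- The two cases are whether the nontrivial eigenvalue of `A ^ k` sits in the normal direction
  -- (`T` is everything) or on the boundary (`T` omits one index, with eigenvalue `-1`).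
  obtain ⟨T, hT, hT', hodd, x, hx⟩ : ∃ T : Finset (Fin (n - 1)), (∀ i ∈ T, d i ^ k = 1) ∧
      (∀ i ∉ T, d i ^ 2 = 1) ∧ Odd k ∧ ∏ i ∈ T, d i ∈ 𝕂.toComplex.fieldRange := by
    obtain ⟨i₀, hi₀⟩ := hk.exists_unique B hB
    have hdet : P.det ∈ 𝕂.toComplex.fieldRange := β.mem_range_det_linearPart γ
    rcases i₀ with i₀ | j
    · have hd : ∀ i, d i ^ k = 1 := fun i => by
        by_contra hi
        exact Sum.inr_ne_inl ((hi₀ (Sum.inr i)).mp hi)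
      refine ⟨Finset.univ, fun i _ => hd i, by simp, ?_, ?_⟩
      · by_contra heven
        have := htriv k (Nat.not_odd_iff_even.mp heven) hk0 (hPpow k hd)
        rw [this] at hk
        exact not_isQuasiReflection_one hk
      · rwa [← det_eq_prod_of_basis b hb, LinearMap.det_toLin']
    · have hj : ∀ i, d i ^ k ≠ 1 ↔ i = j := fun i => by
        simpa [e] using hi₀ (Sum.inr i)
      obtain ⟨h1, h2, h3⟩ := 𝕂.prod_mem_of_unique hD (β.mem_range_trace_linearPart_pow γ) hdet b hb
        hN.ne' hdN hj
      refine ⟨Finset.univ.erase j, fun i hi => ?_, fun i hi => ?_, h2, h3⟩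
      · by_contra hne
        exact Finset.ne_of_mem_erase hi ((hj i).mp hne)
      · have : i = j := by simpa using hi
        rw [this, h1]; norm_num
  -- An element of `K` with `x ^ k = 1` is `±1`, and oddness of `k` excludes `-1`.
  have hprod : ∏ i ∈ T, d i = 1 := by
    have hxk : x ^ k = 1 := 𝕂.toComplex.injective (by
      rw [map_pow, hx, ← Finset.prod_pow, Finset.prod_congr rfl hT, map_one, Finset.prod_const_one])
    rcases 𝕂.eq_one_or_eq_neg_one_of_pow hD hk0 hxk with rfl | rfl
    · rw [← hx, map_one]
    · rw [hodd.neg_one_pow] at hxk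
      rw [← hx, hxk, map_one]
  have hne : ∃ i ∈ T, d i ^ f ≠ 1 := by
    by_contra! hall
    have h2f : ∀ i, d i ^ (2 * f) = 1 := fun i => by
      by_cases hi : i ∈ T
      · rw [mul_comm, pow_mul, hall i hi, one_pow]
      · rw [pow_mul, hT' i hi, one_pow]
    -- Doubling `f` does two things: it kills a possible eigenvalue `-1` of `P`, and it gives the
    -- even exponent needed to handle `z = -1`.
    have h2 := htriv (2 * f) (even_two_mul f) (by omega) (hPpow _ h2f)
    refine hmin (Nat.gcd k (2 * f)) (Nat.gcd_pos_of_pos_left _ (by omega)) ?_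
      (hk.pow_gcd (by omega) h2)
    rw [Nat.Coprime.gcd_mul_left_cancel_right f hodd.coprime_two_left]
    exact (Nat.gcd_le_right _ hf).trans_lt hfk
  have hl : orderOf (A ^ k) * k ≠ 0 := mul_ne_zero hk.1.orderOf_pos.ne' hk0
  have : NeZero (orderOf (A ^ k) * k) := ⟨hl⟩
  have hexp : ∀ i ∈ T, ζ ^ (f * exponent ζ (d i)) = d i ^ f := fun i hi => by
    rw [mul_comm, pow_mul, pow_exponent hζ]
    rw [mul_comm, pow_mul, hT i hi, one_pow]
  have hsum := one_le_sum_fract T (fun i => f * exponent ζ (d i)) hl hζ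
    (by rw [Finset.prod_congr rfl hexp, Finset.prod_pow, hprod, one_pow])
    (by obtain ⟨i, hi, hi'⟩ := hne; exact ⟨i, hi, by rwa [hexp i hi]⟩)
  -- `T` is embedded in the boundary summand of the eigenbasis of `A`, so the normal direction is
  -- not counted.
  have hle := sum_fract_le_sigmaPrime B hB k ζ f (T := T.map .inr) (by
    intro i hi
    obtain ⟨j, hj, rfl⟩ := Finset.mem_map.mp hi
    exact hT j hj)
  rw [Finset.sum_map] at hle
  exact hsum.trans hle
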